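/- Let $\beta>1$ be real and let $\tau_\beta:[0,1]\to[0,1]$, $\tau_\beta(x)=\beta x-[\beta x]$, be the beta-map, where $[y]$ is the integer part of $y$. For $x\in[0,1]$ and $n\ge 1$ put $a_n(\beta,x)=[\beta\,\tau_\beta^{n-1}(x)]$, and for $\lambda\in\mathbb C$ with $|\lambda|>1/\beta$ put $$F_\lambda(x)=\sum_{n=1}^\infty\frac{a_n(\beta,x)}{\beta^n\lambda^n}.$$ Let $BV$ be the space of functions $f:[0,1]\to\mathbb C$ of bounded variation with norm $\|f\|_{BV}=\operatorname{var}(f)+\sup_{[0,1]}|f|$, let $\mathcal N\subset BV$ be the subspace of functions in $BV$ that vanish off a countable set, and let $\widehat{BV}=BV/\mathcal N$ with the quotient norm $\|f\|_{\widehat{BV}}=\inf_{g\in\mathcal N}\|f+g\|_{BV}$. Let $\mathcal L_\beta$ be the Perron-Frobenius operator on $\widehat{BV}$, induced by $$\mathcal L_\beta f(x)=\frac1\beta\sum_{y\in[0,1],\ \tau_\beta(y)=x}f(y)\qquad(f\in BV).$$ A non-leading eigenvalue of $\mathcal L_\beta$ is an eigenvalue $\lambda\neq 1$ with $|\lambda|>1/\beta$.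 If there is one, let $M(\beta)$ be the maximum of $|\lambda|$ over all non-leading eigenvalues $\lambda$; a non-leading eigenvalue is sub-leading if $|\lambda|=M(\beta)$. An eigenvalue $\lambda$ is simple if its generalized eigenspace $\{f\in\widehat{BV} : (\lambda I-\mathcal L_\beta)^n f=0\text{ for some }n\ge1\}$ has dimension $1$. **Theorem.** Suppose that $\mathcal L_\beta$ has at least one non-leading eigenvalue and that all the sub-leading eigenvalues $\lambda_1,\dots,\lambda_N$ (listed without repetition) are simple. Let $K\ge 1$, let $x_0,\dots,x_{N+K}\in[0,1]$ be pairwise distinct, and let $c_0,\dots,c_{N+K}\in\mathbb C$ satisfy the $(N+1)\times(N+K+1)$ linear system $$\begin{pmatrix} x_0&\cdots&x_{N+K}\\ F_{\lambda_1}(x_0)&\cdots&F_{\lambda_1}(x_{N+K})\\ \vdots&&\vdots\\ F_{\lambda_N}(x_0)&\cdots&F_{\lambda_N}(x_{N+K})\end{pmatrix}\begin{pmatrix}c_0\\ \vdots\\ c_{N+K}\end{pmatrix}=0 .$$ Then the step function $f=\sum_{i=0}^{N+K}c_i\mathbf 1_{[0,x_i]}$ has a good decay rate of correlations: there are $C>0$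 and $\alpha$ with $1/\beta\le\alpha<M(\beta)$ such that $$\|\mathcal L_\beta^n f\|_{\widehat{BV}}\le C\alpha^n\qquad\text{for all } n\ge1 .$$ -/

import Mathlib

open scoped unitInterval ENNReal

noncomputable section

namespace BetaPF

/-! ### The beta-map and the greedy digits -/

/-- The beta-map `τ_β(x) = βx - [βx]` on `[0,1]`. -/
def tau (β : ℝ) (x : I) : I :=
  ⟨Int.fract (β * x), Int.fract_nonneg _, (Int.fract_lt_one _).le⟩

/-- Greedy digits, indexed from zero: `digit β x n = [β τ_β^n(x)]` is the digit `a_{n+1}(β, x)`. -/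
def digit (β : ℝ) (x : I) (n : ℕ) : ℕ := ⌊β * ((tau β)^[n] x : ℝ)⌋₊

/-- `F_λ(x) = ∑_{n ≥ 1} a_n(β, x) / (β^n λ^n)`; the series converges absolutely if `|λ| > 1/β`. -/
def greedyF (β : ℝ) (lam : ℂ) (x : I) : ℂ :=
  ∑' n : ℕ, (digit β x n : ℂ) / ((β : ℂ) ^ (n + 1) * lam ^ (n + 1))

/-! ### Functions of bounded variation -/

lemma eVariationOn_add_le' (f g : I → ℂ) :
    eVariationOn (f + g) Set.univ ≤ eVariationOn f Set.univ + eVariationOn g Set.univ := by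
  rw [eVariationOn]
  refine iSup_le fun p => ?_
  calc ∑ i ∈ Finset.range p.1, edist ((f + g) (p.2.1 (i + 1))) ((f + g) (p.2.1 i))
      ≤ ∑ i ∈ Finset.range p.1, (edist (f (p.2.1 (i + 1))) (f (p.2.1 i)) +
          edist (g (p.2.1 (i + 1))) (g (p.2.1 i))) :=
        Finset.sum_le_sum fun i _ => edist_add_add_le _ _ _ _
    _ ≤ _ := by
        rw [Finset.sum_add_distrib]
        exact add_le_add (eVariationOn.sum_le p.2.2.1 p.2.2.2)
          (eVariationOn.sum_le p.2.2.1 p.2.2.2)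

lemma eVariationOn_smul' (c : ℂ) (f : I → ℂ) :
    eVariationOn (c • f) Set.univ = ‖c‖ₑ * eVariationOn f Set.univ := by
  simp only [eVariationOn, ENNReal.mul_iSup, Finset.mul_sum, Pi.smul_apply]
  refine iSup_congr fun p => Finset.sum_congr rfl fun i _ => ?_
  rw [edist_smul₀, ENNReal.smul_def, smul_eq_mul]
  rfl

/-- The complex functions on `[0,1]` of bounded variation, as a subspace of all functions. -/
def bvSubmodule : Submodule ℂ (I → ℂ) where
  carrier := {f | BoundedVariationOn f Set.univ}
  add_mem' {f g} hf hg :=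
    ne_top_of_le_ne_top (ENNReal.add_ne_top.2 ⟨hf, hg⟩) (eVariationOn_add_le' f g)
  zero_mem' := by
    have h : eVariationOn (0 : I → ℂ) Set.univ = 0 :=
      eVariationOn.constant_on (by rintro _ ⟨_, _, rfl⟩ _ ⟨_, _, rfl⟩; rfl)
    simp [BoundedVariationOn, h]
  smul_mem' c f hf := by
    change eVariationOn (c • f) Set.univ ≠ ∞
    rw [eVariationOn_smul']
    exact ENNReal.mul_ne_top (by simp) hf

/-- The space `BV`. It is a type of its own, so that it carries the `BV` norm below and not the
topology of pointwise convergence. -/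
def BV : Type := bvSubmodule

instance : AddCommGroup BV := inferInstanceAs (AddCommGroup bvSubmodule)

instance : Module ℂ BV := inferInstanceAs (Module ℂ bvSubmodule)

instance : CoeFun BV (fun _ => I → ℂ) := ⟨fun f => f.1⟩

lemma BV.ext {f g : BV} (h : ∀ x, f x = g x) : f = g := Subtype.ext (funext h)

lemma BV.add_apply (f g : BV) (x : I) : (f + g) x = f x + g x := rfl

lemma BV.smul_apply (c : ℂ) (f : BV) (x : I) : (c • f) x = c * f x := rfl

lemma BV.zero_apply (x : I) : (0 : BV) x = 0 := rfl

/-- The `BV` norm `var(f) + sup |f|`. -/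
instance : Norm BV := ⟨fun f => (eVariationOn f Set.univ).toReal + ⨆ x : I, ‖f x‖⟩

lemma BV.norm_def (f : BV) : ‖f‖ = (eVariationOn f Set.univ).toReal + ⨆ x : I, ‖f x‖ := rfl

lemma BV.bddAbove (f : BV) : BddAbove (Set.range fun x : I => ‖f x‖) := by
  refine ⟨‖f 0‖ + (eVariationOn f Set.univ).toReal, ?_⟩
  rintro _ ⟨x, rfl⟩
  have h := BoundedVariationOn.dist_le (f := (f : I → ℂ)) f.2 (Set.mem_univ x) (Set.mem_univ 0)
  rw [dist_eq_norm] at h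
  have h2 : ‖f x‖ ≤ ‖f x - f 0‖ + ‖f 0‖ := by
    simpa using norm_add_le (f x - f 0) (f 0)
  change ‖f x‖ ≤ _
  linarith

lemma BV.core : NormedSpace.Core ℂ BV where
  norm_nonneg f := add_nonneg ENNReal.toReal_nonneg (Real.iSup_nonneg fun _ => norm_nonneg _)
  norm_smul c f := by
    have h1 : (eVariationOn (c • f : BV) Set.univ).toReal
        = ‖c‖ * (eVariationOn f Set.univ).toReal := by
      have := eVariationOn_smul' c f
      change (eVariationOn (c • (f : I → ℂ)) Set.univ).toReal = _
      rw [this, ENNReal.toReal_mul]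
      simp
    have h2 : (⨆ x : I, ‖(c • f : BV) x‖) = ‖c‖ * ⨆ x : I, ‖f x‖ := by
      simp only [BV.smul_apply, norm_mul]
      rw [Real.mul_iSup_of_nonneg (norm_nonneg c)]
    rw [BV.norm_def, BV.norm_def, h1, h2]
    ring
  norm_triangle f g := by
    have h1 : (eVariationOn (f + g : BV) Set.univ).toReal
        ≤ (eVariationOn f Set.univ).toReal + (eVariationOn g Set.univ).toReal := by
      rw [← ENNReal.toReal_add f.2 g.2]
      exact ENNReal.toReal_mono (ENNReal.add_ne_top.2 ⟨f.2, g.2⟩) (eVariationOn_add_le' f g)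
    have h2 : (⨆ x : I, ‖(f + g : BV) x‖) ≤ (⨆ x : I, ‖f x‖) + ⨆ x : I, ‖g x‖ :=
      ciSup_le fun x => (norm_add_le _ _).trans
        (add_le_add (le_ciSup f.bddAbove x) (le_ciSup g.bddAbove x))
    simp only [BV.norm_def]
    linarith
  norm_eq_zero_iff f := by
    constructor
    · intro h
      have h1 : 0 ≤ (eVariationOn f Set.univ).toReal := ENNReal.toReal_nonneg
      refine BV.ext fun x => ?_
      have h2 : ‖f x‖ ≤ ⨆ x : I, ‖f x‖ := le_ciSup f.bddAbove x
      rw [BV.norm_def] at h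
      have h3 : ‖f x‖ ≤ 0 := by linarith
      exact norm_le_zero_iff.1 h3
    · rintro rfl
      have h : eVariationOn (0 : BV) Set.univ = 0 :=
        eVariationOn.constant_on (by rintro _ ⟨_, _, rfl⟩ _ ⟨_, _, rfl⟩; rfl)
      simp [BV.norm_def, h, BV.zero_apply]

instance : NormedAddCommGroup BV := NormedAddCommGroup.ofCore BV.core

instance : NormedSpace ℂ BV := NormedSpace.ofCore BV.core

/-- The subspace `𝓝` of functions in `BV` that vanish off a countable set. -/
def nullBV : Submodule ℂ BV where
  carrier := {f | ∃ S : Set I, S.Countable ∧ ∀ x ∉ S, f x = 0}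
  add_mem' := by
    rintro f g ⟨S, hS, hf⟩ ⟨T, hT, hg⟩
    refine ⟨S ∪ T, hS.union hT, fun x hx => ?_⟩
    rw [Set.mem_union, not_or] at hx
    rw [BV.add_apply, hf x hx.1, hg x hx.2, add_zero]
  zero_mem' := ⟨∅, Set.countable_empty, fun _ _ => rfl⟩
  smul_mem' := by
    rintro c f ⟨S, hS, hf⟩
    exact ⟨S, hS, fun x hx => by rw [BV.smul_apply, hf x hx, mul_zero]⟩

/-- The quotient of `BV` by the functions that vanish off a countable set, with the quotient
norm `‖[f]‖ = inf {‖f + g‖ ; g ∈ 𝓝}`. -/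
abbrev BVhat : Type := BV ⧸ nullBV

lemma boundedVariationOn_of_antitone {χ : I → ℝ} (h : Antitone χ) (h1 : ∀ x, |χ x| ≤ 1) :
    BoundedVariationOn χ Set.univ := by
  have h2 : BoundedVariationOn (fun x => -χ x) Set.univ :=
    MonotoneOn.boundedVariationOn (C := 1) (fun x _ y _ hxy => neg_le_neg (h hxy))
      (fun x _ => by simpa using h1 x)
  have h3 := (LipschitzWith.id (α := ℝ)).neg.comp_boundedVariationOn h2
  have h4 : (-id : ℝ → ℝ) ∘ (fun x => -χ x) = χ := by
    funext x
    simp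
  rwa [h4] at h3

/-- Cutting a function of bounded variation down to an initial segment. -/
lemma boundedVariationOn_ite {P : I → Prop} [DecidablePred P] (hP : ∀ x y, x ≤ y → P y → P x) {f : I → ℂ}
    (hf : BoundedVariationOn f Set.univ) :
    BoundedVariationOn (fun x => if P x then f x else 0) Set.univ := by
  have hχ : BoundedVariationOn (fun x => if P x then (1 : ℝ) else 0) Set.univ := by
    refine boundedVariationOn_of_antitone (fun x y hxy => ?_) (fun x => ?_)
    · by_cases hy : P y
      · simp [hy, hP x y hxy hy]
      · simp only [hy, if_false]
        split_ifs <;> simp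
    · split_ifs <;> simp
  have h := hχ.smul hf
  have h2 : (fun x => if P x then (1 : ℝ) else 0) • f = fun x => if P x then f x else 0 := by
    funext x
    by_cases hx : P x <;> simp [hx]
  rwa [h2] at h

/-- The indicator function of `[0, a]` as an element of `BV`. -/
def indBV (a : I) : BV :=
  ⟨Set.indicator (Set.Icc 0 a) 1, by
    have h1 : BoundedVariationOn (fun _ : I => (1 : ℂ)) Set.univ := by
      have h : eVariationOn (fun _ : I => (1 : ℂ)) Set.univ = 0 :=
        eVariationOn.constant_on (by rintro _ ⟨_, _, rfl⟩ _ ⟨_, _, rfl⟩; rfl)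
      simp [BoundedVariationOn, h]
    have h := boundedVariationOn_ite (P := fun x => x ∈ Set.Icc 0 a)
      (fun x y hxy hy => ⟨x.2.1, hxy.trans hy.2⟩) h1
    have h2 : Set.indicator (Set.Icc 0 a) 1
        = fun x : I => if x ∈ Set.Icc 0 a then (1 : ℂ) else 0 := by
      funext x
      simp [Set.indicator_apply]
    change BoundedVariationOn _ _
    rw [h2]
    exact h⟩

/-! ### The Perron-Frobenius operator -/

/-- `(𝓛_β f)(x) = (1/β) ∑_{y : τ_β(y) = x} f(y)`, for an arbitrary function `f`. The sum is a
finite one for `β > 1`. -/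
def pfFun (β : ℝ) (f : I → ℂ) (x : I) : ℂ :=
  (1 / (β : ℂ)) * ∑ᶠ (y : I) (_ : y ∈ {y : I | tau β y = x}), f y

/-- The inverse branch `x ↦ (x + k)/β` (clipped to `[0,1]`). -/
def branch (β : ℝ) (k : ℕ) (x : I) : I :=
  Set.projIcc (0 : ℝ) 1 zero_le_one ((x + k) / β)

lemma branch_monotone {β : ℝ} (hβ : 1 < β) (k : ℕ) : Monotone (branch β k) := by
  intro x y hxy
  have h0 : 0 < β := by linarith
  refine Set.monotone_projIcc _ ?_
  have : (x : ℝ) ≤ y := hxy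
  gcongr

lemma branch_coe {β : ℝ} (hβ : 1 < β) {k : ℕ} {x : I} (h : (x : ℝ) + k ≤ β) :
    (branch β k x : ℝ) = (x + k) / β := by
  have h0 : 0 < β := by linarith
  have h1 : 0 ≤ (x : ℝ) := x.2.1
  rw [branch, Set.projIcc_of_mem zero_le_one ⟨by positivity, by rwa [div_le_one h0]⟩]

/-- The fibre of `τ_β` over `x` consists of the values of the inverse branches that exist at `x`. -/
lemma fiber_eq {β : ℝ} (hβ : 1 < β) (x : I) :
    {y : I | tau β y = x} = (fun k => branch β k x) ''
      {k : ℕ | k ∈ Finset.range (⌊β⌋₊ + 1) ∧ (x : ℝ) < 1 ∧ (x : ℝ) + k ≤ β} := by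
  have h0 : 0 < β := by linarith
  ext y
  simp only [Set.mem_ofPred_eq, Set.mem_image]
  constructor
  · intro hy
    have hy' : Int.fract (β * y) = x := congrArg Subtype.val hy
    have hy0 : 0 ≤ β * (y : ℝ) := mul_nonneg h0.le y.2.1
    have hyβ : β * (y : ℝ) ≤ β := by nlinarith [y.2.2]
    have hsum : (x : ℝ) + (⌊β * (y : ℝ)⌋₊ : ℝ) = β * y := by
      rw [← hy', natCast_floor_eq_intCast_floor hy0]
      exact Int.fract_add_floor _
    have hle : (x : ℝ) + (⌊β * (y : ℝ)⌋₊ : ℝ) ≤ β := by rw [hsum]; exact hyβ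
    refine ⟨⌊β * (y : ℝ)⌋₊, ⟨?_, ?_, hle⟩, ?_⟩
    · rw [Finset.mem_range, Nat.lt_succ_iff]
      exact Nat.floor_mono hyβ
    · rw [← hy']
      exact Int.fract_lt_one _
    · apply Subtype.ext
      rw [branch_coe hβ hle, hsum]
      field_simp
  · rintro ⟨k, ⟨-, hx1, hk⟩, rfl⟩
    apply Subtype.ext
    change Int.fract (β * (branch β k x : ℝ)) = x
    rw [branch_coe hβ hk, mul_div_cancel₀ _ h0.ne', Int.fract_add_natCast]
    exact Int.fract_eq_self.2 ⟨x.2.1, hx1⟩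

lemma fiber_finite {β : ℝ} (hβ : 1 < β) (x : I) : {y : I | tau β y = x}.Finite := by
  rw [fiber_eq hβ]
  exact ((Finset.range (⌊β⌋₊ + 1)).finite_toSet.subset fun k hk => hk.1).image _

lemma pfFun_eq {β : ℝ} (hβ : 1 < β) (f : I → ℂ) (x : I) :
    pfFun β f x = (1 / (β : ℂ)) * ∑ k ∈ Finset.range (⌊β⌋₊ + 1),
      if (x : ℝ) < 1 ∧ (x : ℝ) + k ≤ β then f (branch β k x) else 0 := by
  have h0 : 0 < β := by linarith
  rw [pfFun, fiber_eq hβ, finsum_mem_image]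
  · congr 1
    rw [← Finset.sum_filter, ← finsum_mem_coe_finset]
    congr 1
    funext k
    have hk : (k ∈ {k : ℕ | k ∈ Finset.range (⌊β⌋₊ + 1) ∧ (x : ℝ) < 1 ∧ (x : ℝ) + k ≤ β}) =
        (k ∈ ((Finset.range (⌊β⌋₊ + 1)).filter
          fun k : ℕ => (x : ℝ) < 1 ∧ (x : ℝ) + k ≤ β : Set ℕ)) := by simp
    rw [hk]
  · intro j hj k hk hjk
    have h := congrArg Subtype.val hjk
    simp only at h
    rw [branch_coe hβ hj.2.2, branch_coe hβ hk.2.2, div_left_inj' h0.ne'] at h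
    have h2 : (j : ℝ) = k := by linarith
    exact_mod_cast h2

lemma pfFun_mem {β : ℝ} (hβ : 1 < β) (f : BV) : pfFun β f ∈ bvSubmodule := by
  have h : pfFun β f = (1 / (β : ℂ)) • ∑ k ∈ Finset.range (⌊β⌋₊ + 1),
      fun x : I => if (x : ℝ) < 1 ∧ (x : ℝ) + k ≤ β then f (branch β k x) else 0 := by
    funext x
    rw [pfFun_eq hβ, Pi.smul_apply, Finset.sum_apply, smul_eq_mul]
  rw [h]
  refine Submodule.smul_mem _ _ (Submodule.sum_mem _ fun k _ => ?_)
  change BoundedVariationOn _ _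
  refine boundedVariationOn_ite (P := fun x : I => (x : ℝ) < 1 ∧ (x : ℝ) + k ≤ β)
    (f := fun x => f (branch β k x)) ?_ ?_
  · rintro x y hxy ⟨h1, h2⟩
    have hxy' : (x : ℝ) ≤ y := hxy
    exact ⟨by linarith, by linarith⟩
  · exact ne_top_of_le_ne_top f.2 (eVariationOn.comp_le_of_monotoneOn (f : I → ℂ) (branch β k)
      ((branch_monotone hβ k).monotoneOn _) (Set.mapsTo_univ _ _))

/-- The Perron-Frobenius operator `𝓛_β` on `BV`. -/
def pfBV (β : ℝ) (hβ : 1 < β) : BV →ₗ[ℂ] BV where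
  toFun f := ⟨pfFun β f, pfFun_mem hβ f⟩
  map_add' f g := BV.ext fun x => by
    change pfFun β (fun y => f y + g y) x = pfFun β f x + pfFun β g x
    rw [pfFun, pfFun, pfFun, finsum_mem_add_distrib (fiber_finite hβ x), mul_add]
  map_smul' c f := BV.ext fun x => by
    change pfFun β (fun y => c * f y) x = c * pfFun β f x
    rw [pfFun, pfFun, ← mul_finsum_mem]
    ring

lemma pfBV_null (β : ℝ) (hβ : 1 < β) : nullBV ≤ nullBV.comap (pfBV β hβ) := by
  rintro f ⟨S, hS, hf⟩
  refine ⟨tau β '' S, hS.image _, fun x hx => ?_⟩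
  change pfFun β f x = 0
  rw [pfFun, finsum_mem_eq_zero_of_forall_eq_zero, mul_zero]
  intro y hy
  exact hf y fun hyS => hx ⟨y, hyS, hy⟩

/-- The Perron-Frobenius operator `𝓛_β` on the quotient space. -/
def pf (β : ℝ) (hβ : 1 < β) : Module.End ℂ BVhat :=
  nullBV.mapQ nullBV (pfBV β hβ) (pfBV_null β hβ)

/-! ### Non-leading and sub-leading eigenvalues, decay -/

/-- A non-leading eigenvalue: an eigenvalue other than `1` outside the disc of radius `1/β`, which
is the essential spectral radius. (Spectral values outside this disc are isolated.) -/
def IsNonLeading (β : ℝ) (hβ : 1 < β) (lam : ℂ) : Prop :=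
  (pf β hβ).HasEigenvalue lam ∧ 1 / β < ‖lam‖ ∧ lam ≠ 1

/-- `M(β)`, the largest modulus of a non-leading eigenvalue. -/
def secondModulus (β : ℝ) (hβ : 1 < β) : ℝ :=
  sSup {r : ℝ | ∃ lam : ℂ, IsNonLeading β hβ lam ∧ r = ‖lam‖}

/-- A sub-leading eigenvalue: a non-leading eigenvalue of modulus `M(β)`. -/
def IsSubLeading (β : ℝ) (hβ : 1 < β) (lam : ℂ) : Prop :=
  IsNonLeading β hβ lam ∧ ‖lam‖ = secondModulus β hβ

/-- Algebraic multiplicity one: the generalized eigenspace is one-dimensional. -/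
def IsSimpleEigenvalue (β : ℝ) (hβ : 1 < β) (lam : ℂ) : Prop :=
  Module.finrank ℂ ((pf β hβ).maxGenEigenspace lam) = 1

/-- `f` has a good decay rate of correlations: `‖𝓛_β^n f‖ ≤ C α^n` in the quotient norm for all
`n ≥ 1`, with some `C > 0` and some `α` such that `1/β ≤ α < M(β)`. -/
def HasGoodDecay (β : ℝ) (hβ : 1 < β) (f : BVhat) : Prop :=
  ∃ C : ℝ, 0 < C ∧ ∃ α : ℝ, 1 / β ≤ α ∧ α < secondModulus β hβ ∧
    ∀ n : ℕ, 1 ≤ n → ‖((pf β hβ) ^ n) f‖ ≤ C * α ^ n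

/-- The matrix with first row `x_0, …, x_m` and with the rows `F_{λ_j}(x_0), …, F_{λ_j}(x_m)`
below it. -/
def decayMatrix (β : ℝ) {N m : ℕ} (lam : Fin N → ℂ) (x : Fin m → I) :
    Matrix (Fin (N + 1)) (Fin m) ℂ :=
  Matrix.of (Fin.cons (fun i => ((x i : ℝ) : ℂ)) (fun j i => greedyF β (lam j) (x i)))

/-- The class of the step function `∑ c_i 1_{[0, x_i]}`. -/
def stepBVhat {m : ℕ} (c : Fin m → ℂ) (x : Fin m → I) : BVhat :=
  nullBV.mkQ (∑ i, c i • indBV (x i))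

end BetaPF

end

open scoped Matrix

open scoped unitInterval ENNReal

noncomputable section

namespace BetaPF

open Filter Topology

/-! ### Power series with bounded coefficients and their quotients -/

/-- The power series `∑ a_n w^(n+1)`. -/
def shiftedSeries (a : ℕ → ℂ) (w : ℂ) : ℂ := ∑' n, a n * w ^ (n + 1)

lemma summable_norm_mul_pow {a : ℕ → ℂ} {B : ℝ} (ha : ∀ n, ‖a n‖ ≤ B) {w : ℂ} (hw : ‖w‖ < 1) :
    Summable fun n => ‖a n * w ^ n‖ := by
  refine Summable.of_nonneg_of_le (fun _ => norm_nonneg _) (fun n => ?_)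
    ((summable_geometric_of_lt_one (norm_nonneg w) hw).mul_left B)
  rw [norm_mul, norm_pow]
  gcongr
  exact ha n

lemma shiftedSeries_eq_mul (a : ℕ → ℂ) (w : ℂ) :
    shiftedSeries a w = w * ∑' n, a n * w ^ n := by
  rw [shiftedSeries, ← tsum_mul_left]
  exact tsum_congr fun n => by ring

lemma hasDerivAt_shiftedSeries {a : ℕ → ℂ} {B : ℝ} (ha : ∀ n, ‖a n‖ ≤ B) {w : ℂ} (hw : ‖w‖ < 1) :
    HasDerivAt (shiftedSeries a) (∑' n, a n * ((n + 1 : ℕ) * w ^ n)) w := by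
  obtain ⟨r, hwr, hr1⟩ := exists_between hw
  have hr0 : 0 ≤ r := (norm_nonneg w).trans hwr.le
  have hB : 0 ≤ B := (norm_nonneg _).trans (ha 0)
  have hsum : Summable fun n : ℕ => B * ((n + 1 : ℕ) * r ^ n) := by
    have h1 : Summable fun n : ℕ => (n : ℝ) ^ 1 * r ^ n :=
      summable_pow_mul_geometric_of_norm_lt_one 1 (by rwa [Real.norm_of_nonneg hr0])
    refine ((h1.add (summable_geometric_of_lt_one hr0 hr1)).mul_left B).congr fun n => ?_
    push_cast
    ring
  refine hasDerivAt_tsum_of_isPreconnected (g := fun n w => a n * w ^ (n + 1))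
    (g' := fun n w => a n * ((n + 1 : ℕ) * w ^ n)) hsum
    (Metric.isOpen_ball (x := (0 : ℂ)) (ε := r))
    (convex_ball _ _).isPreconnected (fun n y _ => ?_) (fun n y hy => ?_) (y₀ := 0) ?_ ?_ ?_
  · simpa using (hasDerivAt_pow (n + 1) y).const_mul (a n)
  · rw [mem_ball_zero_iff] at hy
    rw [norm_mul, norm_mul, norm_pow, Complex.norm_natCast]
    gcongr
    exact ha n
  · simpa using (norm_nonneg w).trans_lt hwr
  · simp
  · simpa using hwr

lemma differentiableOn_shiftedSeries {a : ℕ → ℂ} {B : ℝ} (ha : ∀ n, ‖a n‖ ≤ B) :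
    DifferentiableOn ℂ (shiftedSeries a) (Metric.ball 0 1) := fun _ hw =>
  (hasDerivAt_shiftedSeries ha (by simpa using hw)).differentiableAt.differentiableWithinAt

/-- The quotient of two functions, with removable singularities at the simple zeros of the
denominator filled in. -/
def simpleQuotient (f g : ℂ → ℂ) (w : ℂ) : ℂ := if g w = 0 then deriv f w / deriv g w else f w / g w

lemma analyticAt_simpleQuotient {f g : ℂ → ℂ} {w : ℂ} (hf : AnalyticAt ℂ f w)
    (hg : AnalyticAt ℂ g w) (h : g w = 0 → f w = 0 ∧ deriv g w ≠ 0) :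
    AnalyticAt ℂ (simpleQuotient f g) w := by
  by_cases hw : g w = 0
  · obtain ⟨hfw, hgw⟩ := h hw
    have key : ∀ {k : ℂ → ℂ}, AnalyticAt ℂ k w → AnalyticAt ℂ (dslope k w) w := by
      intro k hk
      obtain ⟨s, hs, hks⟩ := hk.exists_mem_nhds_analyticOnNhd
      exact ((Complex.differentiableOn_dslope hs).2 hks.differentiableOn).analyticAt hs
    have hd : dslope g w w ≠ 0 := by rwa [dslope_same]
    refine ((key hf).div (key hg) hd).congr ?_
    have hne : ∀ᶠ z in 𝓝[≠] w, g z ≠ 0 :=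
      hg.differentiableAt.hasDerivAt.eventually_ne hgw
    rw [eventually_nhdsWithin_iff] at hne
    filter_upwards [hne] with z hz
    by_cases hzw : z = w
    · subst hzw
      simp [simpleQuotient, hw]
    · have hgz := hz hzw
      have hsub : z - w ≠ 0 := sub_ne_zero.2 hzw
      simp only [Pi.div_apply, simpleQuotient, hgz, if_false, dslope_of_ne _ hzw, slope_def_field,
        hfw, hw, sub_zero]
      field_simp
  · refine (hf.div hg hw).congr ?_
    filter_upwards [hg.continuousAt.eventually_ne hw] with z hz
    simp [simpleQuotient, hz]

/-- The recursion satisfied by the Taylor coefficients of `∑ b_n w^(n+1) / (1 - ∑ a_n w^(n+1))`,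
together with the bound on the coefficients given by the domain of analyticity. -/
lemma exists_quotient_coeff {a b : ℕ → ℂ} {A B : ℝ} (ha : ∀ n, ‖a n‖ ≤ A) (hb : ∀ n, ‖b n‖ ≤ B)
    {r₀ : ℝ} (hr₀ : 0 < r₀) (hr₀1 : r₀ < 1)
    (hzero : ∀ w : ℂ, ‖w‖ ≤ r₀ → shiftedSeries a w = 1 →
      shiftedSeries b w = 0 ∧ ∑' n, a n * ((n + 1 : ℕ) * w ^ n) ≠ 0) :
    ∃ q : ℕ → ℂ, ∃ C r : ℝ, 0 < C ∧ r₀ < r ∧ r < 1 ∧ q 0 = 0 ∧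
      (∀ n, q (n + 1) = b n + ∑ p ∈ Finset.HasAntidiagonal.antidiagonal n, q p.1 * a p.2) ∧
      ∀ n, ‖q n‖ ≤ C * r⁻¹ ^ n := by
  set D : ℂ → ℂ := fun w => 1 - shiftedSeries a w with hD
  set Q := simpleQuotient (shiftedSeries b) D with hQ
  have han : ∀ {e : ℕ → ℂ} {E : ℝ}, (∀ n, ‖e n‖ ≤ E) → ∀ w : ℂ, ‖w‖ < 1 →
      AnalyticAt ℂ (shiftedSeries e) w := fun he w hw =>
    (differentiableOn_shiftedSeries he).analyticAt (Metric.isOpen_ball.mem_nhds (by simpa using hw))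
  have hQan : ∀ w : ℂ, ‖w‖ ≤ r₀ → AnalyticAt ℂ Q w := by
    intro w hw
    have hw1 := hw.trans_lt hr₀1
    refine analyticAt_simpleQuotient (han hb w hw1) (analyticAt_const.sub (han ha w hw1)) fun h => ?_
    obtain ⟨h1, h2⟩ := hzero w hw (sub_eq_zero.1 h).symm
    refine ⟨h1, ?_⟩
    rw [((hasDerivAt_shiftedSeries ha hw1).const_sub 1).deriv]
    exact neg_ne_zero.2 h2
  obtain ⟨δ, hδ, hsub⟩ := (isCompact_closedBall (0 : ℂ) r₀).exists_cthickening_subset_open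
    (isOpen_analyticAt ℂ Q) fun w hw => hQan w (by simpa using hw)
  rw [cthickening_closedBall hδ.le hr₀.le] at hsub
  obtain ⟨r, hr, hr'⟩ := exists_between (lt_min (lt_add_of_pos_left r₀ hδ) hr₀1)
  have hr0 : 0 < r := hr₀.trans hr
  have hr1 : r < 1 := hr'.trans_le (min_le_right _ _)
  lift r to NNReal using hr0.le
  have hser : HasFPowerSeriesOnBall Q (cauchyPowerSeries Q 0 r) 0 r := by
    refine DifferentiableOn.hasFPowerSeriesOnBall (fun w hw => ?_) (by exact_mod_cast hr0)
    exact (hsub (Metric.closedBall_subset_closedBall (hr'.le.trans (min_le_left _ _))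
      hw)).differentiableAt.differentiableWithinAt
  set q : ℕ → ℂ := (cauchyPowerSeries Q 0 r).coeff with hq
  have hqle : ∃ C : ℝ, 0 < C ∧ ∀ n, ‖q n‖ ≤ C * (r : ℝ)⁻¹ ^ n := by
    refine ⟨max 1 ((2 * Real.pi)⁻¹ * ∫ θ in (0 : ℝ)..2 * Real.pi, ‖Q (circleMap 0 r θ)‖),
      by positivity, fun n => ?_⟩
    rw [hq, ← FormalMultilinearSeries.norm_apply_eq_norm_coef]
    refine (norm_cauchyPowerSeries_le Q 0 r n).trans ?_
    rw [abs_of_pos hr0]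
    gcongr
    exact le_max_right _ _
  obtain ⟨C, hC, hqC⟩ := hqle
  set e : ℕ → ℂ := fun n => match n with
    | 0 => 0
    | n + 1 => b n + ∑ p ∈ Finset.HasAntidiagonal.antidiagonal n, q p.1 * a p.2 with he
  have hqe : q = e := by
    have h1 : HasFPowerSeriesAt Q (cauchyPowerSeries Q 0 r) 0 := hser.hasFPowerSeriesAt
    have h2 : HasFPowerSeriesAt Q (FormalMultilinearSeries.ofScalars ℂ e) 0 := by
      rw [hasFPowerSeriesAt_iff]
      have hs0 : shiftedSeries a 0 = 0 := by simp [shiftedSeries]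
      have hD0 : ∀ᶠ w in 𝓝 0, D w ≠ 0 := by
        refine ContinuousAt.eventually_ne ?_ (by simp [hD, hs0])
        exact (analyticAt_const.sub (han ha 0 (by simp))).continuousAt
      filter_upwards [hD0, Metric.ball_mem_nhds (0 : ℂ) hr0] with w hw hwr
      rw [mem_ball_zero_iff] at hwr
      have hw1 := hwr.trans hr1
      have hqs : Summable fun n => ‖q n * w ^ n‖ := by
        have hlt : ‖w‖ / r < 1 := (div_lt_one hr0).2 hwr
        refine Summable.of_nonneg_of_le (fun _ => norm_nonneg _) (fun n => ?_)
          ((summable_geometric_of_lt_one (by positivity) hlt).mul_left C)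
        rw [norm_mul, norm_pow, div_pow, div_eq_mul_inv, ← inv_pow]
        calc _ ≤ C * (r : ℝ)⁻¹ ^ n * ‖w‖ ^ n := by gcongr; exact hqC n
          _ = _ := by ring
      have hQsum : Q w = ∑' n, q n * w ^ n := by
        have h3 := hser.hasSum (y := w) (by
          rw [Metric.mem_eball, edist_zero_right]
          exact_mod_cast hwr)
        rw [zero_add] at h3
        rw [← h3.tsum_eq]
        refine tsum_congr fun n => ?_
        rw [FormalMultilinearSeries.apply_eq_pow_smul_coeff, smul_eq_mul, mul_comm]
      have has := summable_norm_mul_pow ha hw1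
      have hbs := summable_norm_mul_pow hb hw1
      have hprod : Q w * (∑' n, a n * w ^ n)
          = ∑' n, (∑ p ∈ Finset.HasAntidiagonal.antidiagonal n, q p.1 * a p.2) * w ^ n := by
        rw [hQsum, tsum_mul_tsum_eq_tsum_sum_antidiagonal_of_summable_norm hqs has]
        refine tsum_congr fun n => ?_
        rw [Finset.sum_mul]
        refine Finset.sum_congr rfl fun p hp => ?_
        rw [← Finset.HasAntidiagonal.mem_antidiagonal.1 hp]
        ring
      have hps : Summable fun n =>
          (∑ p ∈ Finset.HasAntidiagonal.antidiagonal n, q p.1 * a p.2) * w ^ n := by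
        have h3 := (summable_norm_sum_mul_antidiagonal_of_summable_norm hqs has).of_norm
        refine h3.congr fun n => ?_
        rw [Finset.sum_mul]
        refine Finset.sum_congr rfl fun p hp => ?_
        rw [← Finset.HasAntidiagonal.mem_antidiagonal.1 hp]
        ring
      have hfix : Q w = w * (∑' n, b n * w ^ n) + w * (Q w * ∑' n, a n * w ^ n) := by
        have h3 : Q w = shiftedSeries b w / D w := by
          rw [hQ, simpleQuotient, if_neg hw]
        have h4 : Q w * D w = shiftedSeries b w := by rw [h3, div_mul_cancel₀ _ hw]
        rw [hD] at h4
        simp only [shiftedSeries_eq_mul] at h4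
        linear_combination h4
      have hes : HasSum (fun n => e (n + 1) * w ^ (n + 1)) (Q w) := by
        rw [hfix, ← mul_add, hprod]
        have h3 : (fun n => e (n + 1) * w ^ (n + 1)) = fun n => w * (b n * w ^ n +
            (∑ p ∈ Finset.HasAntidiagonal.antidiagonal n, q p.1 * a p.2) * w ^ n) := by
          funext n
          simp only [he]
          ring
        rw [h3]
        exact (hbs.of_norm.hasSum.add hps.hasSum).mul_left w
      simp only [FormalMultilinearSeries.coeff_ofScalars, zero_add, smul_eq_mul]
      rw [← hasSum_nat_add_iff' 1]
      simpa [he, mul_comm] using hes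
    have h3 := h1.eq_formalMultilinearSeries h2
    funext n
    rw [hq, h3, FormalMultilinearSeries.coeff_ofScalars]
  refine ⟨q, C, r, hC, hr, hr1, congrFun hqe 0, fun n => congrFun hqe (n + 1), hqC⟩

/-! ### The operator on indicator functions -/

lemma indBV_apply (a x : I) : indBV a x = if x ≤ a then 1 else 0 := by
  change Set.indicator (Set.Icc 0 a) 1 x = _
  have : (0 : I) ≤ x := x.2.1
  simp [Set.indicator_apply, this]

lemma norm_indBV_apply_le (a x : I) : ‖indBV a x‖ ≤ 1 := by
  rw [indBV_apply]
  split_ifs <;> simp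

lemma eVariationOn_indBV_le (a : I) : eVariationOn (indBV a : I → ℂ) Set.univ ≤ 1 := by
  have hmono : MonotoneOn (fun x : I => if x ≤ a then (0 : ℝ) else 1) Set.univ := by
    intro x _ y _ hxy
    by_cases hy : y ≤ a
    · simp [hy, hxy.trans hy]
    · simp only [hy, if_false]
      split_ifs <;> simp
  have h1 : eVariationOn (fun x : I => if x ≤ a then (0 : ℝ) else 1) Set.univ ≤ 1 := by
    have h := hmono.eVariationOn_eq (Set.mem_univ 0) (Set.mem_univ 1)
    have hI : Set.univ ∩ Set.Icc (0 : I) 1 = Set.univ := by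
      ext x
      simp only [Set.univ_inter, Set.mem_Icc, Set.mem_univ, iff_true]
      exact x.2
    rw [hI] at h
    rw [h]
    refine ENNReal.ofReal_le_one.2 ?_
    split_ifs <;> norm_num
  have hL : LipschitzWith 1 (fun t : ℝ => (1 : ℂ) - (t : ℂ)) := by
    refine LipschitzWith.of_dist_le_mul fun s t => ?_
    rw [dist_eq_norm, dist_eq_norm, sub_sub_sub_cancel_left, ← Complex.ofReal_sub,
      Complex.norm_real, norm_sub_rev]
    simp
  have h2 : (indBV a : I → ℂ)
      = (fun t : ℝ => (1 : ℂ) - (t : ℂ)) ∘ fun x : I => if x ≤ a then (0 : ℝ) else 1 := by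
    funext x
    rw [indBV_apply, Function.comp_apply]
    split_ifs <;> simp
  rw [h2]
  refine ((hL.lipschitzOnWith (s := Set.univ)).comp_eVariationOn_le (Set.mapsTo_univ _ _)).trans ?_
  simpa using h1

lemma norm_mk_indBV_le (a : I) : ‖nullBV.mkQ (indBV a)‖ ≤ 2 := by
  refine (Submodule.Quotient.norm_mk_le nullBV (indBV a)).trans ?_
  rw [BV.norm_def]
  have h1 : (eVariationOn (indBV a) Set.univ).toReal ≤ 1 :=
    ENNReal.toReal_le_of_le_ofReal zero_le_one (by simpa using eVariationOn_indBV_le a)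
  have h2 : ⨆ x : I, ‖indBV a x‖ ≤ 1 := ciSup_le fun x => norm_indBV_apply_le a x
  linarith

lemma pfFun_indBV {β : ℝ} (hβ : 1 < β) (t : I) {x : I} (hx : (x : ℝ) < 1) :
    pfFun β (indBV t) x = (1 / (β : ℂ)) * (digit β t 0 + indBV (tau β t) x) := by
  have h0 : 0 < β := by linarith
  rw [pfFun_eq hβ]
  congr 1
  have ht0 : 0 ≤ β * (t : ℝ) := mul_nonneg h0.le t.2.1
  have htβ : β * (t : ℝ) ≤ β := by nlinarith [t.2.2]
  have hx0 : (0 : ℝ) ≤ x := x.2.1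
  have hd : digit β t 0 = ⌊β * (t : ℝ)⌋₊ := rfl
  have hfr : ((tau β t : I) : ℝ) = β * t - ⌊β * (t : ℝ)⌋₊ := by
    change Int.fract (β * (t : ℝ)) = _
    rw [natCast_floor_eq_intCast_floor ht0]
    rfl
  set d := ⌊β * (t : ℝ)⌋₊ with hdef
  have hd1 : (d : ℝ) ≤ β * t := Nat.floor_le ht0
  have hd2 : β * (t : ℝ) < d + 1 := Nat.lt_floor_add_one _
  have hterm : ∀ k : ℕ, (if (x : ℝ) < 1 ∧ (x : ℝ) + k ≤ β then indBV t (branch β k x) else 0)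
      = (if k < d then (1 : ℂ) else 0) + if k = d then indBV (tau β t) x else 0 := by
    intro k
    have hiff : ((x : ℝ) + k ≤ β ∧ branch β k x ≤ t) ↔ (x : ℝ) + k ≤ β * t := by
      constructor
      · rintro ⟨h1, h2⟩
        have h3 : ((branch β k x : I) : ℝ) ≤ t := h2
        rw [branch_coe hβ h1, div_le_iff₀ h0] at h3
        linarith
      · intro h
        have h1 := h.trans htβ
        refine ⟨h1, ?_⟩
        change ((branch β k x : I) : ℝ) ≤ t
        rw [branch_coe hβ h1, div_le_iff₀ h0]
        linarith
    have hlhs : (if (x : ℝ) < 1 ∧ (x : ℝ) + k ≤ β then indBV t (branch β k x) else 0)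
        = if (x : ℝ) + k ≤ β * t then (1 : ℂ) else 0 := by
      rw [indBV_apply, ← ite_and, if_congr (by rw [and_assoc, hiff]) rfl rfl]
      simp [hx]
    rw [hlhs, indBV_apply]
    have hle : x ≤ tau β t ↔ (x : ℝ) ≤ β * t - d := by rw [← hfr]; rfl
    simp only [hle]
    rcases lt_trichotomy k d with h | h | h
    · have h' : (k : ℝ) + 1 ≤ d := by exact_mod_cast h
      have : (x : ℝ) + k ≤ β * t := by linarith
      simp [this, h, h.ne]
    · subst h
      simp [le_sub_iff_add_le]
    · have h' : (d : ℝ) + 1 ≤ k := by exact_mod_cast h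
      have : ¬ (x : ℝ) + k ≤ β * t := by
        rw [not_le]
        linarith
      simp [this, h.not_gt, h.ne']
  have hdle : d ≤ ⌊β⌋₊ := Nat.floor_mono htβ
  simp only [hterm]
  rw [Finset.sum_add_distrib, ← Finset.sum_filter, Finset.sum_ite_eq' (Finset.range (⌊β⌋₊ + 1)),
    if_pos (Finset.mem_range.2 (by omega)), hd]
  have hfil : (Finset.range (⌊β⌋₊ + 1)).filter (fun k => k < d) = Finset.range d := by
    ext k
    simp only [Finset.mem_filter, Finset.mem_range]
    omega
  rw [hfil]
  simp

lemma mkQ_eq_of_forall_lt_one {f g : BV} (h : ∀ x : I, (x : ℝ) < 1 → f x = g x) :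
    nullBV.mkQ f = nullBV.mkQ g := by
  rw [Submodule.mkQ_apply, Submodule.mkQ_apply, Submodule.Quotient.eq]
  refine ⟨{1}, Set.countable_singleton _, fun x hx => ?_⟩
  have hx1 : (x : ℝ) < 1 := lt_of_le_of_ne x.2.2 fun h1 => hx (Subtype.ext h1)
  change f x - g x = 0
  rw [h x hx1, sub_self]

lemma pf_mkQ (β : ℝ) (hβ : 1 < β) (f : BV) :
    pf β hβ (nullBV.mkQ f) = nullBV.mkQ (pfBV β hβ f) := rfl

lemma pf_indBV (β : ℝ) (hβ : 1 < β) (t : I) :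
    pf β hβ (nullBV.mkQ (indBV t)) = (1 / (β : ℂ)) •
      ((digit β t 0 : ℂ) • nullBV.mkQ (indBV 1) + nullBV.mkQ (indBV (tau β t))) := by
  rw [pf_mkQ, ← map_smul, ← map_add, ← map_smul]
  refine mkQ_eq_of_forall_lt_one fun x hx => ?_
  change pfFun β (indBV t) x = _
  rw [pfFun_indBV hβ t hx, BV.smul_apply, BV.add_apply, BV.smul_apply, indBV_apply 1,
    if_pos (show x ≤ 1 from x.2.2), mul_one]

lemma digit_iterate (β : ℝ) (x : I) (n : ℕ) : digit β ((tau β)^[n] x) 0 = digit β x n := rfl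

lemma digit_le {β : ℝ} (hβ : 1 < β) (x : I) (n : ℕ) : (digit β x n : ℝ) ≤ β := by
  have h0 : 0 < β := by linarith
  have h1 := ((tau β)^[n] x).2.1
  have h2 := ((tau β)^[n] x).2.2
  refine (Nat.floor_le (mul_nonneg h0.le h1)).trans ?_
  nlinarith

lemma norm_digit_le {β : ℝ} (hβ : 1 < β) (x : I) (n : ℕ) : ‖(digit β x n : ℂ)‖ ≤ β := by
  rw [Complex.norm_natCast]
  exact digit_le hβ x n

/-- The greedy expansion `x = ∑ a_n(β, x) / β^n`. -/
lemma hasSum_digit {β : ℝ} (hβ : 1 < β) (x : I) :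
    HasSum (fun n => (digit β x n : ℝ) * β⁻¹ ^ (n + 1)) x := by
  have h0 : 0 < β := by linarith
  have hb : β⁻¹ < 1 := inv_lt_one_of_one_lt₀ hβ
  have hpart : ∀ n, ∑ k ∈ Finset.range n, (digit β x k : ℝ) * β⁻¹ ^ (k + 1)
      = x - β⁻¹ ^ n * ((tau β)^[n] x : I) := by
    intro n
    induction n with
    | zero => simp
    | succ n ih =>
      rw [Finset.sum_range_succ, ih, Function.iterate_succ_apply']
      have h1 : ((tau β ((tau β)^[n] x) : I) : ℝ) = β * ((tau β)^[n] x : I) - digit β x n := by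
        change Int.fract (β * (((tau β)^[n] x : I) : ℝ)) = _
        rw [digit, natCast_floor_eq_intCast_floor (mul_nonneg h0.le ((tau β)^[n] x).2.1)]
        rfl
      rw [h1, pow_succ]
      field_simp
      ring
  rw [hasSum_iff_tendsto_nat_of_nonneg (fun n => by positivity)]
  simp only [hpart]
  have h2 : Tendsto (fun n => β⁻¹ ^ n * (((tau β)^[n] x : I) : ℝ)) atTop (𝓝 0) := by
    refine squeeze_zero (fun n => mul_nonneg (by positivity) ((tau β)^[n] x).2.1)
      (fun n => mul_le_of_le_one_right (by positivity) ((tau β)^[n] x).2.2)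
      (tendsto_pow_atTop_nhds_zero_of_lt_one (by positivity) hb)
  simpa using h2.const_sub (x : ℝ)

/-! ### Eigenvalues are bounded -/

lemma norm_eigenvalue_le (β : ℝ) (hβ : 1 < β) {μ : ℂ} (h : (pf β hβ).HasEigenvalue μ) :
    ‖μ‖ ≤ 2 := by
  have h0 : 0 < β := by linarith
  by_contra! hμ
  obtain ⟨v, hv, hv0⟩ := h.exists_hasEigenvector
  obtain ⟨f, rfl⟩ := Submodule.mkQ_surjective _ v
  rw [Module.End.mem_eigenspace_iff, pf_mkQ, ← map_smul, Submodule.mkQ_apply,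
    Submodule.mkQ_apply, Submodule.Quotient.eq] at hv
  obtain ⟨S, hS, hfS⟩ := hv
  have hfix : ∀ x ∉ S, μ * f x = pfFun β f x := fun x hx =>
    (sub_eq_zero.1 (hfS x hx)).symm
  obtain ⟨B, hB⟩ := f.bddAbove
  have hB' : ∀ x, ‖f x‖ ≤ B := fun x => hB ⟨x, rfl⟩
  have hB0 : 0 ≤ B := (norm_nonneg _).trans (hB' 0)
  have hμ0 : 0 < ‖μ‖ := by linarith
  have hstep : ∀ n : ℕ, {x : I | B * (2 / ‖μ‖) ^ n < ‖f x‖}.Countable := by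
    intro n
    induction n with
    | zero =>
      convert Set.countable_empty
      ext x
      simpa using hB' x
    | succ n ih =>
      refine (hS.union (ih.image (tau β))).mono fun x hx => ?_
      by_contra hxn
      rw [Set.mem_union, not_or] at hxn
      have hpre : ∀ y, tau β y = x → ‖f y‖ ≤ B * (2 / ‖μ‖) ^ n := fun y hy => by
        by_contra! hlt
        exact hxn.2 ⟨y, hlt, hy⟩
      have hs0 : 0 ≤ B * (2 / ‖μ‖) ^ n := by positivity
      have hle : ‖μ‖ * ‖f x‖ ≤ 2 * (B * (2 / ‖μ‖) ^ n) := by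
        rw [← norm_mul, hfix x hxn.1, pfFun_eq hβ, norm_mul]
        have hsum : ‖∑ k ∈ Finset.range (⌊β⌋₊ + 1),
            if (x : ℝ) < 1 ∧ (x : ℝ) + k ≤ β then f (branch β k x) else 0‖
            ≤ (⌊β⌋₊ + 1 : ℕ) * (B * (2 / ‖μ‖) ^ n) := by
          refine (norm_sum_le_of_le _ (n := fun _ => B * (2 / ‖μ‖) ^ n) fun k hk => ?_).trans ?_
          · split_ifs with hc
            · refine hpre _ ?_
              have : branch β k x ∈ {y : I | tau β y = x} := by
                rw [fiber_eq hβ]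
                exact ⟨k, ⟨hk, hc⟩, rfl⟩
              exact this
            · simpa using hs0
          · simp
        have hβn : ‖1 / (β : ℂ)‖ = 1 / β := by
          rw [norm_div, norm_one, Complex.norm_real, Real.norm_of_nonneg h0.le]
        rw [hβn]
        have hfl : ((⌊β⌋₊ + 1 : ℕ) : ℝ) ≤ 2 * β := by
          have := Nat.floor_le h0.le
          push_cast
          linarith
        calc 1 / β * _ ≤ 1 / β * (2 * β * (B * (2 / ‖μ‖) ^ n)) := by
              gcongr
              exact hsum.trans (by gcongr)
          _ = _ := by field_simp
      have hlt : B * (2 / ‖μ‖) ^ (n + 1) < ‖f x‖ := hx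
      have : B * (2 / ‖μ‖) ^ (n + 1) = 2 * (B * (2 / ‖μ‖) ^ n) / ‖μ‖ := by
        rw [pow_succ]
        ring
      rw [this, div_lt_iff₀ hμ0] at hlt
      linarith
  refine hv0 ((Submodule.Quotient.mk_eq_zero _).2 ⟨_, Set.countable_iUnion hstep, fun x hx => ?_⟩)
  by_contra hfx
  have hlim : Tendsto (fun n => B * (2 / ‖μ‖) ^ n) atTop (𝓝 0) := by
    simpa using (tendsto_pow_atTop_nhds_zero_of_lt_one (by positivity)
      ((div_lt_one hμ0).2 hμ)).const_mul B
  obtain ⟨n, hn⟩ := (hlim.eventually_lt_const (norm_pos_iff.2 hfx)).exists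
  exact hx (Set.mem_iUnion.2 ⟨n, hn⟩)

lemma bddAbove_nonLeading (β : ℝ) (hβ : 1 < β) :
    BddAbove {r : ℝ | ∃ lam : ℂ, IsNonLeading β hβ lam ∧ r = ‖lam‖} := by
  refine ⟨2, ?_⟩
  rintro _ ⟨μ, hμ, rfl⟩
  exact norm_eigenvalue_le β hβ hμ.1

/-! ### Combinations of indicator functions along the orbit of `1` -/

lemma summable_mul_indBV {u : ℕ → ℂ} (hu : Summable fun n => ‖u n‖) (t : ℕ → I) (x : I) :
    Summable fun n => u n * indBV (t n) x := by
  refine Summable.of_norm_bounded hu fun n => ?_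
  rw [norm_mul]
  exact mul_le_of_le_one_right (norm_nonneg _) (norm_indBV_apply_le _ _)

/-- The function `∑ u_n 1_{[0, τ^n(1)]}`, for an absolutely summable sequence `u`. -/
def orbitBV (β : ℝ) (u : ℕ → ℂ) (hu : Summable fun n => ‖u n‖) : BV :=
  ⟨fun x => ∑' n, u n * indBV ((tau β)^[n] 1) x, by
    have hfin : ∑' n, ‖u n‖ₑ ≠ ∞ :=
      ENNReal.tsum_coe_ne_top_iff_summable.2 (NNReal.summable_coe.1 hu)
    refine ne_top_of_le_ne_top hfin ?_
    rw [eVariationOn]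
    refine iSup_le fun p => ?_
    have hterm : ∀ x y : I, edist (∑' n, u n * indBV ((tau β)^[n] 1) x)
        (∑' n, u n * indBV ((tau β)^[n] 1) y)
        ≤ ∑' n, ‖u n‖ₑ * edist (indBV ((tau β)^[n] 1) x) (indBV ((tau β)^[n] 1) y) := by
      intro x y
      rw [edist_eq_enorm_sub,
        ← (summable_mul_indBV hu _ x).tsum_sub (summable_mul_indBV hu _ y)]
      refine enorm_tsum_le_tsum_enorm.trans (ENNReal.tsum_le_tsum fun n => ?_)
      rw [← mul_sub, enorm_mul, edist_eq_enorm_sub]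
    refine (Finset.sum_le_sum fun i _ => hterm _ _).trans ?_
    rw [← Summable.tsum_finsetSum fun i _ => ENNReal.summable]
    refine ENNReal.tsum_le_tsum fun n => ?_
    rw [← Finset.mul_sum]
    refine mul_le_of_le_one_right' ?_
    exact (eVariationOn.sum_le p.2.2.1 p.2.2.2).trans (eVariationOn_indBV_le _)⟩

lemma orbitBV_apply (β : ℝ) {u : ℕ → ℂ} (hu : Summable fun n => ‖u n‖) (x : I) :
    orbitBV β u hu x = ∑' n, u n * indBV ((tau β)^[n] 1) x := rfl

lemma summable_mul_digit {β : ℝ} (hβ : 1 < β) (t : I) {u : ℕ → ℂ} (hu : Summable fun n => ‖u n‖) :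
    Summable fun n => u n * digit β t n := by
  refine Summable.of_norm_bounded (hu.mul_right β) fun n => ?_
  rw [norm_mul]
  gcongr
  exact norm_digit_le hβ t n

lemma pfFun_orbitBV {β : ℝ} (hβ : 1 < β) {u : ℕ → ℂ} (hu : Summable fun n => ‖u n‖) {x : I}
    (hx : (x : ℝ) < 1) :
    pfFun β (orbitBV β u hu) x = (1 / (β : ℂ)) *
      (∑' n, u n * digit β 1 n + ∑' n, u n * indBV ((tau β)^[n + 1] 1) x) := by
  have h1 : pfFun β (orbitBV β u hu) x = ∑' n, u n * pfFun β (indBV ((tau β)^[n] 1)) x := by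
    simp only [pfFun_eq hβ]
    have h2 : ∀ k : ℕ, (if (x : ℝ) < 1 ∧ (x : ℝ) + k ≤ β
        then orbitBV β u hu (branch β k x) else 0)
        = ∑' n, u n * (if (x : ℝ) < 1 ∧ (x : ℝ) + k ≤ β
          then indBV ((tau β)^[n] 1) (branch β k x) else 0) := by
      intro k
      split_ifs
      · rfl
      · simp
    simp only [h2]
    rw [← Summable.tsum_finsetSum, ← tsum_mul_left]
    · refine tsum_congr fun n => ?_
      rw [← Finset.mul_sum]
      ring
    · intro k _
      split_ifs
      · exact summable_mul_indBV hu _ _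
      · simp
  rw [h1, ← (summable_mul_digit hβ 1 hu).tsum_add
    (summable_mul_indBV hu (fun n => (tau β)^[n + 1] 1) x), ← tsum_mul_left]
  refine tsum_congr fun n => ?_
  rw [pfFun_indBV hβ _ hx, digit_iterate, Function.iterate_succ_apply']
  ring

lemma tau_lt_one (β : ℝ) (x : I) : tau β x < 1 := Int.fract_lt_one (β * (x : ℝ))

lemma not_countable_of_Ioo_subset {S : Set I} {l : I} (hl : l < 1) (h : Set.Ioo l 1 ⊆ S) :
    ¬ S.Countable := by
  intro hS
  have h1 : Set.Ioo (l : ℝ) 1 ⊆ Subtype.val '' S := fun y hy =>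
    ⟨⟨y, l.2.1.trans hy.1.le, hy.2.le⟩, h ⟨hy.1, hy.2⟩, rfl⟩
  have h2 := (hS.image Subtype.val).mono h1
  rw [← Cardinal.le_aleph0_iff_set_countable, Cardinal.mk_Ioo_real (by exact_mod_cast hl)] at h2
  exact h2.not_gt Cardinal.aleph0_lt_continuum

lemma summable_norm_geometric {w : ℂ} (hw : ‖w‖ < 1) : Summable fun n : ℕ => ‖w ^ n‖ := by
  simpa using summable_norm_pow_mul_geometric_of_norm_lt_one 0 hw

lemma summable_norm_mul_geometric {w : ℂ} (hw : ‖w‖ < 1) :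
    Summable fun n : ℕ => ‖(n : ℂ) * w ^ n‖ := by
  simpa using summable_norm_pow_mul_geometric_of_norm_lt_one 1 hw

lemma indBV_one_apply (x : I) : indBV 1 x = 1 := by
  rw [indBV_apply, if_pos (show x ≤ 1 from x.2.2)]

/-- The function `∑ w^n 1_{[0, τ^n(1)]}` has the left limit `1` at `1`. -/
lemma mkQ_orbitBV_geometric_ne_zero (β : ℝ) {w : ℂ} (hw : ‖w‖ < 1) :
    nullBV.mkQ (orbitBV β (fun n => w ^ n) (summable_norm_geometric hw)) ≠ 0 := by
  intro h0
  obtain ⟨S, hS, hfS⟩ := (Submodule.Quotient.mk_eq_zero _).1 h0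
  have hpos : 0 < 1 - ‖w‖ := sub_pos.2 hw
  obtain ⟨m, hm⟩ := exists_pow_lt_of_lt_one hpos hw
  set l : I := (Finset.range m).sup fun n => (tau β)^[n + 1] 1 with hl
  have hl1 : l < 1 := by
    rw [hl, Finset.sup_lt_iff (show (⊥ : I) < 1 from zero_lt_one)]
    intro n _
    rw [Function.iterate_succ_apply']
    exact tau_lt_one _ _
  refine not_countable_of_Ioo_subset hl1 (fun x hx => ?_) hS
  by_contra hxS
  have hgx := hfS x hxS
  have hs := summable_mul_indBV (summable_norm_geometric hw) (fun n => (tau β)^[n] 1) x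
  rw [orbitBV_apply, hs.tsum_eq_zero_add] at hgx
  simp only [pow_zero, Function.iterate_zero, id_eq, one_mul, indBV_one_apply] at hgx
  have hs1 : Summable fun n => w ^ (n + 1) * indBV ((tau β)^[n + 1] 1) x :=
    (summable_nat_add_iff 1).2 hs
  rw [← hs1.sum_add_tsum_nat_add m, Finset.sum_eq_zero, zero_add] at hgx
  · have h1 : ‖∑' n, w ^ (n + m + 1) * indBV ((tau β)^[n + m + 1] 1) x‖
        ≤ ‖w‖ ^ m * (1 - ‖w‖)⁻¹ := by
      refine tsum_of_norm_bounded
        ((hasSum_geometric_of_lt_one (norm_nonneg w) hw).mul_left (‖w‖ ^ m)) fun n => ?_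
      rw [norm_mul, norm_pow, ← pow_add]
      refine (mul_le_of_le_one_right (by positivity) (norm_indBV_apply_le _ _)).trans ?_
      exact pow_le_pow_of_le_one (norm_nonneg _) hw.le (by omega)
    have h2 : ‖w‖ ^ m * (1 - ‖w‖)⁻¹ < 1 := by
      rw [← div_eq_mul_inv, div_lt_one hpos]
      exact hm
    rw [← eq_neg_iff_add_eq_zero] at hgx
    rw [← norm_neg, ← hgx, norm_one] at h1
    linarith
  · intro n hn
    have hlt : (tau β)^[n + 1] 1 < x :=
      (Finset.le_sup (f := fun n => (tau β)^[n + 1] 1) hn).trans_lt hx.1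
    rw [indBV_apply, if_neg hlt.not_ge, mul_zero]

/-! ### Eigenfunctions from the zeros of `1 - ∑ a_n(β, 1) w^n` -/

section Eigenfunctions

variable {β : ℝ} {w : ℂ}

lemma mul_tsum_geometric_indBV (hw : ‖w‖ < 1) (x : I) :
    w * ∑' n, w ^ n * indBV ((tau β)^[n + 1] 1) x
      = orbitBV β (fun n => w ^ n) (summable_norm_geometric hw) x - 1 := by
  have hs := summable_mul_indBV (summable_norm_geometric hw) (fun n => (tau β)^[n] 1) x
  rw [orbitBV_apply, hs.tsum_eq_zero_add, ← tsum_mul_left]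
  simp only [pow_zero, Function.iterate_zero, id_eq, one_mul, indBV_one_apply, add_sub_cancel_left]
  exact tsum_congr fun n => by ring

lemma mul_tsum_mul_geometric_indBV (hw : ‖w‖ < 1) (x : I) :
    w * ∑' n : ℕ, (n : ℂ) * w ^ n * indBV ((tau β)^[n + 1] 1) x
      = orbitBV β (fun n => (n : ℂ) * w ^ n) (summable_norm_mul_geometric hw) x
        - (orbitBV β (fun n => w ^ n) (summable_norm_geometric hw) x - 1) := by
  have hs := summable_mul_indBV (summable_norm_mul_geometric hw) (fun n => (tau β)^[n] 1) x
  have hs1 : Summable fun n : ℕ => ((n + 1 : ℕ) : ℂ) * w ^ (n + 1) *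
      indBV ((tau β)^[n + 1] 1) x := (summable_nat_add_iff 1).2 hs
  have hs2 := (summable_mul_indBV (summable_norm_geometric hw)
    (fun n => (tau β)^[n + 1] 1) x).mul_left w
  rw [orbitBV_apply, hs.tsum_eq_zero_add, ← mul_tsum_geometric_indBV hw, ← tsum_mul_left,
    ← tsum_mul_left, Nat.cast_zero, zero_mul, zero_mul, zero_add, ← hs1.tsum_sub hs2]
  refine tsum_congr fun n => ?_
  push_cast
  ring

lemma pf_orbitBV_geometric (hβ : 1 < β) (hw : ‖w‖ < 1) (hw0 : w ≠ 0)
    (hD : shiftedSeries (fun n => (digit β 1 n : ℂ)) w = 1) :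
    pf β hβ (nullBV.mkQ (orbitBV β (fun n => w ^ n) (summable_norm_geometric hw)))
      = (1 / (β * w)) • nullBV.mkQ (orbitBV β (fun n => w ^ n) (summable_norm_geometric hw)) := by
  have hβ0 : (β : ℂ) ≠ 0 := by exact_mod_cast (zero_lt_one.trans hβ).ne'
  rw [pf_mkQ, ← map_smul]
  refine mkQ_eq_of_forall_lt_one fun x hx => ?_
  change pfFun β _ x = _
  rw [pfFun_orbitBV hβ _ hx, BV.smul_apply]
  have h1 := mul_tsum_geometric_indBV (β := β) hw x
  rw [shiftedSeries_eq_mul] at hD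
  simp only [mul_comm (_ : ℂ) (w ^ _)] at hD
  field_simp
  linear_combination hD + h1

lemma pf_orbitBV_mul_geometric (hβ : 1 < β) (hw : ‖w‖ < 1) (hw0 : w ≠ 0)
    (hD : shiftedSeries (fun n => (digit β 1 n : ℂ)) w = 1)
    (hD' : ∑' n : ℕ, (digit β 1 n : ℂ) * ((n + 1 : ℕ) * w ^ n) = 0) :
    pf β hβ (nullBV.mkQ (orbitBV β (fun n => (n : ℂ) * w ^ n) (summable_norm_mul_geometric hw)))
      = (1 / (β * w)) •
          nullBV.mkQ (orbitBV β (fun n => (n : ℂ) * w ^ n) (summable_norm_mul_geometric hw))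
        - (1 / (β * w)) •
          nullBV.mkQ (orbitBV β (fun n => w ^ n) (summable_norm_geometric hw)) := by
  have hβ0 : (β : ℂ) ≠ 0 := by exact_mod_cast (zero_lt_one.trans hβ).ne'
  rw [pf_mkQ, ← map_smul, ← map_smul, ← map_sub]
  refine mkQ_eq_of_forall_lt_one fun x hx => ?_
  change pfFun β _ x = (1 / (β * w)) * orbitBV β _ (summable_norm_mul_geometric hw) x
    - (1 / (β * w)) * orbitBV β _ (summable_norm_geometric hw) x
  rw [pfFun_orbitBV hβ _ hx]
  have h1 := mul_tsum_mul_geometric_indBV (β := β) hw x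
  rw [shiftedSeries_eq_mul] at hD
  simp only [mul_comm (_ : ℂ) (w ^ _)] at hD
  have h2 : ∑' n : ℕ, (n : ℂ) * w ^ n * digit β 1 n + ∑' n : ℕ, w ^ n * digit β 1 n = 0 := by
    rw [← hD', ← (summable_mul_digit hβ 1 (summable_norm_mul_geometric hw)).tsum_add
      (summable_mul_digit hβ 1 (summable_norm_geometric hw))]
    refine tsum_congr fun n => ?_
    push_cast
    ring
  field_simp
  linear_combination h1 + w * h2 - hD

lemma hasEigenvalue_of_shiftedSeries_eq_one (hβ : 1 < β) (hw : ‖w‖ < 1) (hw0 : w ≠ 0)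
    (hD : shiftedSeries (fun n => (digit β 1 n : ℂ)) w = 1) :
    (pf β hβ).HasEigenvalue (1 / (β * w)) :=
  Module.End.hasEigenvalue_of_hasEigenvector
    ⟨Module.End.mem_eigenspace_iff.2 (pf_orbitBV_geometric hβ hw hw0 hD),
      mkQ_orbitBV_geometric_ne_zero β hw⟩

/-- A simple eigenvalue comes from a simple zero. -/
lemma tsum_ne_zero_of_isSimpleEigenvalue (hβ : 1 < β) (hw : ‖w‖ < 1) (hw0 : w ≠ 0)
    (hD : shiftedSeries (fun n => (digit β 1 n : ℂ)) w = 1)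
    (hs : IsSimpleEigenvalue β hβ (1 / (β * w))) :
    ∑' n : ℕ, (digit β 1 n : ℂ) * ((n + 1 : ℕ) * w ^ n) ≠ 0 := by
  intro hD'
  have hβ0 : (β : ℂ) ≠ 0 := by exact_mod_cast (zero_lt_one.trans hβ).ne'
  have hg := pf_orbitBV_geometric hβ hw hw0 hD
  have hv := pf_orbitBV_mul_geometric hβ hw hw0 hD hD'
  have hg0 := mkQ_orbitBV_geometric_ne_zero β hw
  set g := nullBV.mkQ (orbitBV β (fun n => w ^ n) (summable_norm_geometric hw))
  set v := nullBV.mkQ (orbitBV β (fun n => (n : ℂ) * w ^ n) (summable_norm_mul_geometric hw))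
  set μ : ℂ := 1 / (β * w) with hμ
  have hμ0 : μ ≠ 0 := by
    rw [hμ]
    exact one_div_ne_zero (mul_ne_zero hβ0 hw0)
  have hg1 : (pf β hβ - μ • 1) g = 0 := by
    simp [hg]
  have hv1 : (pf β hβ - μ • 1) v = -(μ • g) := by
    simp [hv]
  have hgm : g ∈ (pf β hβ).maxGenEigenspace μ := by
    rw [Module.End.mem_maxGenEigenspace]
    exact ⟨1, by rw [pow_one, hg1]⟩
  have hvm : v ∈ (pf β hβ).maxGenEigenspace μ := by
    rw [Module.End.mem_maxGenEigenspace]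
    exact ⟨2, by rw [pow_two, Module.End.mul_apply, hv1, map_neg, map_smul, hg1, smul_zero,
      neg_zero]⟩
  obtain ⟨k, hk⟩ := (finrank_eq_one_iff_of_nonzero'
    (⟨g, hgm⟩ : (pf β hβ).maxGenEigenspace μ) (by simpa using hg0)).1 hs ⟨v, hvm⟩
  have hk' : k • g = v := congrArg Subtype.val hk
  rw [← hk', map_smul, hg1, smul_zero, eq_comm, neg_eq_zero, smul_eq_zero] at hv1
  exact hv1.elim hμ0 hg0

end Eigenfunctions

/-- `1` is a simple zero of `1 - ∑ a_n(β, 1) (z/β)^n`. -/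
lemma tsum_digit_deriv_ne_zero {β : ℝ} (hβ : 1 < β) :
    ∑' n : ℕ, (digit β 1 n : ℂ) * ((n + 1 : ℕ) * (β : ℂ)⁻¹ ^ n) ≠ 0 := by
  have h0 : 0 < β := by linarith
  have hw : ‖(β : ℂ)⁻¹‖ < 1 := by
    rw [norm_inv, Complex.norm_real, Real.norm_of_nonneg h0.le]
    exact inv_lt_one_of_one_lt₀ hβ
  have hs : Summable fun n : ℕ => (digit β 1 n : ℂ) * ((n + 1 : ℕ) * (β : ℂ)⁻¹ ^ n) := by
    refine ((summable_mul_digit hβ 1 (summable_norm_mul_geometric hw)).add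
      (summable_mul_digit hβ 1 (summable_norm_geometric hw))).congr fun n => ?_
    push_cast
    ring
  have hcast : ∀ n : ℕ, (digit β 1 n : ℂ) * ((n + 1 : ℕ) * (β : ℂ)⁻¹ ^ n)
      = ((digit β 1 n * ((n + 1 : ℕ) * β⁻¹ ^ n) : ℝ) : ℂ) := fun n => by push_cast; ring
  simp only [hcast] at hs ⊢
  rw [← Complex.ofReal_tsum, Complex.ofReal_ne_zero]
  have hs' := Complex.summable_ofReal.1 hs
  refine (hs'.tsum_pos (fun n => by positivity) 0 ?_).ne'
  have h1 : 1 ≤ digit β 1 0 := Nat.le_floor (by simpa using hβ.le)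
  have h2 : (0 : ℝ) < digit β 1 0 := by exact_mod_cast h1
  simpa using h2

/-! ### Decay of step functions -/

lemma shiftedSeries_digit_eq_greedyF (β : ℝ) (x : I) {w : ℂ} (hβ : (β : ℂ) ≠ 0) :
    shiftedSeries (fun n => (digit β x n : ℂ)) w = greedyF β (1 / (β * w)) x := by
  refine tsum_congr fun n => ?_
  rw [← mul_pow, mul_one_div, div_mul_cancel_left₀ hβ, inv_pow, div_inv_eq_mul]

lemma greedyF_one {β : ℝ} (hβ : 1 < β) (x : I) : greedyF β 1 x = ((x : ℝ) : ℂ) := by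
  rw [greedyF, ← (hasSum_digit hβ x).tsum_eq, Complex.ofReal_tsum]
  refine tsum_congr fun n => ?_
  push_cast
  rw [one_pow, mul_one, inv_pow, div_eq_mul_inv]

lemma shiftedSeries_sum {β : ℝ} (hβ : 1 < β) {m : ℕ} (c : Fin m → ℂ) (x : Fin m → I) {w : ℂ}
    (hw : ‖w‖ < 1) :
    shiftedSeries (fun n => ∑ i, c i * digit β (x i) n) w
      = ∑ i, c i * shiftedSeries (fun n => (digit β (x i) n : ℂ)) w := by
  have hs : ∀ i, Summable fun n => c i * ((digit β (x i) n : ℂ) * w ^ (n + 1)) := fun i => by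
    refine ((summable_norm_mul_pow (norm_digit_le hβ (x i)) hw).of_norm.mul_left
      (c i * w)).congr fun n => ?_
    ring
  simp only [shiftedSeries, ← tsum_mul_left]
  rw [← Summable.tsum_finsetSum fun i _ => hs i]
  refine tsum_congr fun n => ?_
  rw [Finset.sum_mul]
  exact Finset.sum_congr rfl fun i _ => by ring

lemma pf_pow_stepBVhat (β : ℝ) (hβ : 1 < β) {m : ℕ} (c : Fin m → ℂ) (x : Fin m → I) {q : ℕ → ℂ}
    (hq0 : q 0 = 0)
    (hq : ∀ n, q (n + 1) = ∑ i, c i * digit β (x i) n +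
      ∑ p ∈ Finset.HasAntidiagonal.antidiagonal n, q p.1 * digit β 1 p.2) (n : ℕ) :
    (pf β hβ ^ n) (stepBVhat c x) = (1 / (β : ℂ)) ^ n •
      (∑ i, c i • nullBV.mkQ (indBV ((tau β)^[n] (x i))) +
        ∑ p ∈ Finset.HasAntidiagonal.antidiagonal n,
          q p.1 • nullBV.mkQ (indBV ((tau β)^[p.2] 1))) := by
  induction n with
  | zero => simp [stepBVhat, hq0]
  | succ n ih =>
    rw [pow_succ', Module.End.mul_apply, ih, map_smul, map_add, map_sum, map_sum,
      Finset.Nat.sum_antidiagonal_succ', hq]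
    simp only [map_smul, pf_indBV, digit_iterate, Function.iterate_succ_apply',
      Function.iterate_zero, id_eq, smul_add, smul_smul, Finset.sum_add_distrib, Finset.smul_sum,
      Finset.sum_smul, add_smul]
    have h1 : ∀ z d : ℂ, (1 / (β : ℂ)) ^ n * (z * (1 / (β : ℂ) * d))
        = (1 / (β : ℂ)) ^ (n + 1) * (z * d) := fun z d => by ring
    have h2 : ∀ z : ℂ, (1 / (β : ℂ)) ^ n * (z * (1 / (β : ℂ)))
        = (1 / (β : ℂ)) ^ (n + 1) * z := fun z => by ring
    simp only [h1, h2]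
    abel

lemma sum_range_inv_pow_le {r : ℝ} (hr0 : 0 < r) (hr1 : r < 1) (n : ℕ) :
    ∑ k ∈ Finset.range (n + 1), r⁻¹ ^ k ≤ (1 - r)⁻¹ * r⁻¹ ^ n := by
  have hpos : 0 < 1 - r := sub_pos.2 hr1
  induction n with
  | zero => simpa using (one_le_inv₀ hpos).2 (by linarith)
  | succ n ih =>
    rw [Finset.sum_range_succ]
    have h : (1 - r)⁻¹ * r⁻¹ ^ n + r⁻¹ ^ (n + 1) = (1 - r)⁻¹ * r⁻¹ ^ (n + 1) := by
      rw [pow_succ]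
      field_simp
      ring
    linarith

lemma exists_norm_pf_pow_stepBVhat_le (β : ℝ) (hβ : 1 < β) {m : ℕ} (c : Fin m → ℂ) (x : Fin m → I)
    {q : ℕ → ℂ} {C r : ℝ} (hC : 0 < C) (hr0 : 0 < r) (hr1 : r < 1) (hq0 : q 0 = 0)
    (hq : ∀ n, q (n + 1) = ∑ i, c i * digit β (x i) n +
      ∑ p ∈ Finset.HasAntidiagonal.antidiagonal n, q p.1 * digit β 1 p.2)
    (hqC : ∀ n, ‖q n‖ ≤ C * r⁻¹ ^ n) :
    ∃ C' : ℝ, 0 < C' ∧ ∀ n : ℕ, ‖(pf β hβ ^ n) (stepBVhat c x)‖ ≤ C' * (1 / (β * r)) ^ n := by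
  have h0 : 0 < β := by linarith
  have hpos : 0 < 1 - r := sub_pos.2 hr1
  refine ⟨(∑ i, ‖c i‖) * 2 + C * 2 * (1 - r)⁻¹, by positivity, fun n => ?_⟩
  rw [pf_pow_stepBVhat β hβ c x hq0 hq n, norm_smul]
  have hy : 1 ≤ r⁻¹ ^ n := one_le_pow₀ ((one_le_inv₀ hr0).2 hr1.le)
  have h1 : ‖∑ i, c i • nullBV.mkQ (indBV ((tau β)^[n] (x i)))‖ ≤ (∑ i, ‖c i‖) * 2 := by
    rw [Finset.sum_mul]
    refine norm_sum_le_of_le _ fun i _ => ?_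
    rw [norm_smul]
    gcongr
    exact norm_mk_indBV_le _
  have h2 : ‖∑ p ∈ Finset.HasAntidiagonal.antidiagonal n,
      q p.1 • nullBV.mkQ (indBV ((tau β)^[p.2] 1))‖ ≤ C * 2 * ((1 - r)⁻¹ * r⁻¹ ^ n) := by
    refine (norm_sum_le_of_le _ (n := fun p => C * 2 * r⁻¹ ^ p.1) fun p _ => ?_).trans ?_
    · rw [norm_smul]
      calc _ ≤ C * r⁻¹ ^ p.1 * 2 := by
            gcongr
            · exact hqC _
            · exact norm_mk_indBV_le _
        _ = _ := by ring
    · rw [← Finset.mul_sum, Finset.Nat.sum_antidiagonal_eq_sum_range_succ (fun i _ => r⁻¹ ^ i)]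
      gcongr
      exact sum_range_inv_pow_le hr0 hr1 n
  have hβn : ‖(1 / (β : ℂ)) ^ n‖ = (1 / β) ^ n := by
    rw [norm_pow, norm_div, norm_one, Complex.norm_real, Real.norm_of_nonneg h0.le]
  have h3 : (1 / (β * r)) ^ n = (1 / β) ^ n * r⁻¹ ^ n := by
    rw [← mul_pow]
    congr 1
    field_simp
  rw [hβn, h3]
  have h4 : (∑ i, ‖c i‖) * 2 ≤ (∑ i, ‖c i‖) * 2 * r⁻¹ ^ n :=
    le_mul_of_one_le_right (by positivity) hy
  calc _ ≤ (1 / β) ^ n * ((∑ i, ‖c i‖) * 2 * r⁻¹ ^ n + C * 2 * ((1 - r)⁻¹ * r⁻¹ ^ n)) := by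
        gcongr
        exact (norm_add_le _ _).trans (add_le_add (h1.trans h4) h2)
    _ = _ := by ring

end BetaPF

end

open scoped Matrix
theorem theorem4p7 (β : ℝ) (hβ : 1 < β)
    (hex : ∃ μ : ℂ, BetaPF.IsNonLeading β hβ μ)
    (N : ℕ) (lam : Fin N → ℂ) (hinj : Function.Injective lam)
    (hlam : ∀ μ : ℂ, BetaPF.IsSubLeading β hβ μ ↔ ∃ j, lam j = μ)
    (hsimple : ∀ j, BetaPF.IsSimpleEigenvalue β hβ (lam j))
    (K : ℕ) (hK : 1 ≤ K)
    (x : Fin (N + K + 1) → unitInterval) (hx : Function.Injective x)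
    (c : Fin (N + K + 1) → ℂ)
    (hc : BetaPF.decayMatrix β lam x *ᵥ c = 0) :
    BetaPF.HasGoodDecay β hβ (BetaPF.stepBVhat c x) := by
  open BetaPF in
  have h0 : 0 < β := by linarith
  have hβ0 : (β : ℂ) ≠ 0 := by exact_mod_cast h0.ne'
  set M := secondModulus β hβ with hM
  have hleM : ∀ μ : ℂ, IsNonLeading β hβ μ → ‖μ‖ ≤ M := fun μ hμ =>
    le_csSup (bddAbove_nonLeading β hβ) ⟨μ, hμ, rfl⟩
  have hMβ : 1 / β < M := by
    obtain ⟨μ, hμ⟩ := hex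
    exact hμ.2.1.trans_le (hleM μ hμ)
  have hM0 : 0 < M := (by positivity : 0 < 1 / β).trans hMβ
  have hβM : 1 < β * M := by
    rw [div_lt_iff₀ h0] at hMβ
    linarith
  have hrow : ∀ j, ∑ i, c i * greedyF β (lam j) (x i) = 0 := fun j => by
    have h := congrFun hc j.succ
    simpa [Matrix.mulVec, dotProduct, decayMatrix, mul_comm] using h
  have hrow0 : ∑ i, c i * greedyF β 1 (x i) = 0 := by
    have h := congrFun hc 0
    simp only [greedyF_one hβ]
    simpa [Matrix.mulVec, dotProduct, decayMatrix, mul_comm] using h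
  have hb : ∀ n, ‖∑ i, c i * (digit β (x i) n : ℂ)‖ ≤ ∑ i, ‖c i‖ * β := fun n => by
    refine norm_sum_le_of_le _ fun i _ => ?_
    rw [norm_mul]
    gcongr
    exact norm_digit_le hβ _ _
  have hr₀ : 0 < 1 / (β * M) := by positivity
  have hr₀1 : 1 / (β * M) < 1 := (div_lt_one (by positivity)).2 hβM
  obtain ⟨q, C, r, hC, hr, hr1, hq0, hq, hqC⟩ := exists_quotient_coeff (norm_digit_le hβ 1) hb
    hr₀ hr₀1 (by
      intro w hw hD
      have hw1 := hw.trans_lt hr₀1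
      have hw0 : w ≠ 0 := by
        rintro rfl
        simp [shiftedSeries] at hD
      rw [shiftedSeries_sum hβ c x hw1]
      simp only [shiftedSeries_digit_eq_greedyF β _ hβ0]
      by_cases h1 : 1 / (β * w) = 1
      · have hwβ : w = (β : ℂ)⁻¹ := by
          rw [div_eq_one_iff_eq (mul_ne_zero hβ0 hw0)] at h1
          exact eq_inv_of_mul_eq_one_right h1.symm
        rw [h1]
        exact ⟨hrow0, hwβ ▸ tsum_digit_deriv_ne_zero hβ⟩
      · have hnorm : M ≤ ‖1 / (β * w)‖ := by
          rw [norm_div, norm_one, norm_mul, Complex.norm_real, Real.norm_of_nonneg h0.le,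
            le_div_iff₀ (mul_pos h0 (norm_pos_iff.2 hw0))]
          rw [le_div_iff₀ (by positivity)] at hw
          linarith
        have hnl : IsNonLeading β hβ (1 / (β * w)) :=
          ⟨hasEigenvalue_of_shiftedSeries_eq_one hβ hw1 hw0 hD, hMβ.trans_le hnorm, h1⟩
        obtain ⟨j, hj⟩ := (hlam _).1 ⟨hnl, le_antisymm (hleM _ hnl) hnorm⟩
        refine ⟨by rw [← hj]; exact hrow j,
          tsum_ne_zero_of_isSimpleEigenvalue hβ hw1 hw0 hD (hj ▸ hsimple j)⟩)
  have hr0 : 0 < r := hr₀.trans hr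
  obtain ⟨C', hC', hle⟩ := exists_norm_pf_pow_stepBVhat_le β hβ c x hC hr0 hr1 hq0 hq hqC
  refine ⟨C', hC', 1 / (β * r), ?_, ?_, fun n _ => hle n⟩
  · gcongr
    nlinarith
  · rw [div_lt_iff₀ (by positivity)] at hr ⊢
    linarith
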